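/- Let $D\subsetneq\mathbb C$ be a simply connected domain with distinct prime ends $a,b$, let $\phi:D\to\mathbb H$ be a conformal map onto the upper half plane with $\phi(a)=0$, $\phi(b)=\infty$, and let $\gamma:(0,S)\to D$, $0<S\le\infty$, be a simple curve from $a$ to $b$, parametrized so that $\phi\circ\gamma(0,t]$ has half-plane capacity $2t$ for every $t\in[0,S)$. For $0\le t<S$ let $g_t:\mathbb H\setminus\phi(\gamma(0,t])\to\mathbb H$ be the conformal map with $g_t(z)-z\to0$ as $z\to\infty$ (so that $z(g_t(z)-z)\to2t$), put $\phi_t=g_t\circ\phi$ and $D(t)=D\setminus\gamma(0,t]$, let $U(t)=\phi_t(\gamma(t))\in\mathbb R$ (boundary value at the tip; $U(0)=0$) be the driving function, and let $p(t)\in D(t)$ be the point with $\phi_t(p(t))=U(t)+i$. For a domain $V$ and $p\in V$ write $\mathrm{rad}_p(V)=\inf\{|z-p|:z\notin V\}$. Let $T>1$ and $\varepsilon>0$. Then there is a constant $c=c(T,\varepsilon)>0$, depending on $T$ and $\varepsilon$ only, such that for all $D,a,b,\phi,\gamma$ as above, with $$\tilde T=\sup\{t\in[0,T],\ t<S:\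 |U(t)|<1/\varepsilon\},$$ one has $$\mathrm{rad}_{p(t)}(D(t))\ \ge\ c(T,\varepsilon)\,\mathrm{rad}_{p(0)}(D)\qquad\text{for all } t\in[0,\tilde T)\text{ with }|U(t)|<1/\varepsilon ,$$ in particular for all $t<\tilde T$ before the first time at which $|U|$ reaches $1/\varepsilon$. -/

import Mathlib

open Filter Topology Set
open UpperHalfPlane (upperHalfPlaneSet)

/-- The inner radius `rad_p(D) = inf {|z - p| : z ∉ D}`. -/
noncomputable def innerRadius (D : Set ℂ) (p : ℂ) : ℝ := Metric.infDist p Dᶜ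

/-- `f` is a conformal map (biholomorphic bijection) of the open set `V` onto `W`. -/
def IsConformalMapOnto (f : ℂ → ℂ) (V W : Set ℂ) : Prop :=
  DifferentiableOn ℂ f V ∧ BijOn f V W

/-- The filter of points of `V ⊆ ℂ` tending to infinity. -/
noncomputable def atInftyIn (V : Set ℂ) : Filter ℂ := cocompact ℂ ⊓ 𝓟 V

/-- `g` is the map `g_A` for `A ⊆ ℍ`: the conformal map of `ℍ \ A` onto `ℍ` such that
`g(z) - z → 0` as `z → ∞`. -/
def IsMappingOut (g : ℂ → ℂ) (A : Set ℂ) : Prop :=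
  IsConformalMapOnto g (upperHalfPlaneSet \ A) upperHalfPlaneSet ∧
    Tendsto (fun z => g z - z) (atInftyIn (upperHalfPlaneSet \ A)) (𝓝 0)

/-- The half-plane capacity of `A` is `h`, where `g = g_A`: `z (g(z) - z) → h` as `z → ∞`. -/
def HasHalfPlaneCapacity (g : ℂ → ℂ) (A : Set ℂ) (h : ℝ) : Prop :=
  Tendsto (fun z => z * (g z - z)) (atInftyIn (upperHalfPlaneSet \ A)) (𝓝 (h : ℂ))

/-- The slit domain `D(t) = D \ γ(0,t]`. -/
def slitDomain (D : Set ℂ) (γ : ℝ → ℂ) (t : ℝ) : Set ℂ := D \ γ '' Ioc 0 t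

/-- The data of a chordal Loewner chain in the simply connected domain `D ⊊ ℂ`.
* `φ : D → ℍ` is a conformal map. Through `φ`, the prime ends of `D` are the points of `ℝ ∪ {∞}`;
  the start `a` and the end `b` are the prime ends with `φ(a) = 0` and `φ(b) = ∞`. Every pair of
  distinct prime ends arises in this way, for a `φ` unique up to a positive factor.
* `γ : (0,S) → D` is a simple curve from `a` to `b`, with lifetime `S ∈ (0,∞]`.
* `g t` is the map `g_t` of the curve `φ ∘ γ`, so that `φ_t = g_t ∘ φ`.
* The time is half-plane capacity: `hcap (φ ∘ γ (0,t]) = 2t`.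
* `U` is the driving function `U(t) = φ_t(γ(t))`, in the sense of the boundary value of `g_t`
  at the tip `φ(γ(t))`; at `t = 0` this is `φ(a) = 0`. -/
structure IsChordalLoewnerChain (D : Set ℂ) (φ : ℂ → ℂ) (S : EReal) (γ : ℝ → ℂ)
    (g : ℝ → ℂ → ℂ) (U : ℝ → ℝ) : Prop where
  isOpen : IsOpen D
  ne_univ : D ≠ univ
  simplyConnected : IsSimplyConnected D
  conformal : IsConformalMapOnto φ D upperHalfPlaneSet
  lifetime_pos : 0 < S
  continuousOn : ContinuousOn γ {t : ℝ | 0 < t ∧ (t : EReal) < S}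
  injOn : InjOn γ {t : ℝ | 0 < t ∧ (t : EReal) < S}
  mapsTo : MapsTo γ {t : ℝ | 0 < t ∧ (t : EReal) < S} D
  start : Tendsto (fun t => φ (γ t)) (𝓝[>] (0 : ℝ)) (𝓝 0)
  finish : Tendsto (fun t => φ (γ t)) (comap (fun t : ℝ => (t : EReal)) (𝓝[<] S)) (cocompact ℂ)
  mappingOut : ∀ t : ℝ, 0 ≤ t → (t : EReal) < S →
    IsMappingOut (g t) ((fun s => φ (γ s)) '' Ioc 0 t)
  capacity : ∀ t : ℝ, 0 ≤ t → (t : EReal) < S →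
    HasHalfPlaneCapacity (g t) ((fun s => φ (γ s)) '' Ioc 0 t) (2 * t)
  driving_zero : U 0 = 0
  driving : ∀ t : ℝ, 0 < t → (t : EReal) < S →
    Tendsto (g t) (𝓝[upperHalfPlaneSet \ (fun s => φ (γ s)) '' Ioc 0 t] (φ (γ t)))
      (𝓝 (U t : ℂ))

/-- `p(t) ∈ D(t)` is the point with `φ_t(p(t)) = U(t) + i`, for all `t ∈ [0,S)`. -/
def IsReferencePoint (D : Set ℂ) (φ : ℂ → ℂ) (S : EReal) (γ : ℝ → ℂ)
    (g : ℝ → ℂ → ℂ) (U : ℝ → ℝ) (p : ℝ → ℂ) : Prop :=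
  ∀ t : ℝ, 0 ≤ t → (t : EReal) < S →
    p t ∈ slitDomain D γ t ∧ g t (φ (p t)) = (U t : ℂ) + Complex.I

/-- `T̃ = sup {t ∈ [0,T] : |U(t)| < 1/ε}`, over the times `t` before the lifetime `S`. -/
noncomputable def lastTime (S : EReal) (U : ℝ → ℝ) (T ε : ℝ) : ℝ :=
  sSup {t : ℝ | t ∈ Icc 0 T ∧ (t : EReal) < S ∧ |U t| < 1 / ε}

/-! Let `ψ` be the inverse of `φ` and `f` that of `g t`. Then `ψ ∘ f` maps the half plane onto
`D(t)` and takes `U(t) + i` to `p(t)`, while `ψ` takes `i` to `p(0)`. By Koebe's theorem, the inner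
radius at the image of a point is comparable to the height of the point times the norm of the
derivative, and it changes by a bounded factor over a bounded hyperbolic distance
(`half_pow_mul_innerRadius_le`).

The map `f` is uncontrolled near the real line but tame higher up. Schwarz–Pick with one point sent
to infinity turns the capacity `2t ≤ 2T` into `|f(w) - w| ≤ 2t / Im w` (`im_le_and_norm_sub_le`), so
at height `8T` the map is almost the identity and `|f'| ≥ 1/2`.

The two radii are joined in three moves: climb from `U(t) + i` to `z = U(t) + 8Ti` inside `D(t)`;
compare `D(t)` with `D` at the common point `ψ(f(z))`, where the derivatives differ only by the
factor `f'(z)`; go from `f(z)` to `i` inside `D`. All distances are at most `1/ε + 8T`. -/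

/-! ### Inverses of injective holomorphic maps. -/

section Univalent

variable {V : Set ℂ} {f g : ℂ → ℂ}

/-- An injective holomorphic map is open at every point. -/
theorem nhds_le_map_nhds_of_injOn (hV : IsOpen V) (hf : DifferentiableOn ℂ f V)
    (hi : InjOn f V) {z : ℂ} (hz : z ∈ V) : 𝓝 (f z) ≤ map f (𝓝 z) := by
  refine (hf.analyticAt (hV.mem_nhds hz)).eventually_constant_or_nhds_le_map_nhds.resolve_left ?_
  intro hc
  have h1 : ∀ᶠ w in 𝓝[≠] z, f w = f z ∧ w ∈ V ∧ w ≠ z :=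
    (hc.filter_mono nhdsWithin_le_nhds).and
      (Filter.Eventually.and (mem_nhdsWithin_of_mem_nhds (hV.mem_nhds hz))
        self_mem_nhdsWithin)
  obtain ⟨w, hw, hwV, hne⟩ := h1.exists
  exact hne (hi hwV hz hw)

theorem continuousAt_of_leftInvOn (hV : IsOpen V) (hf : DifferentiableOn ℂ f V)
    (hg : LeftInvOn g f V) {z : ℂ} (hz : z ∈ V) : ContinuousAt g (f z) := by
  have h1 := nhds_le_map_nhds_of_injOn hV hf hg.injOn hz
  have h2 : map (g ∘ f) (𝓝 z) = 𝓝 z := by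
    have : g ∘ f =ᶠ[𝓝 z] id := by
      filter_upwards [hV.mem_nhds hz] with w hw using hg hw
    rw [map_congr this, map_id]
  rw [ContinuousAt, hg hz, Tendsto]
  calc map g (𝓝 (f z)) ≤ map g (map f (𝓝 z)) := map_mono h1
    _ = 𝓝 z := by rw [map_map, h2]

/-- The inverse of an injective holomorphic map is holomorphic. -/
theorem differentiableAt_of_leftInvOn (hV : IsOpen V) (hf : DifferentiableOn ℂ f V)
    (hg : LeftInvOn g f V) {z : ℂ} (hz : z ∈ V) : DifferentiableAt ℂ g (f z) := by
  have hcont := continuousAt_of_leftInvOn hV hf hg hz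
  have hopen : ∀ x ∈ V, ∀ᶠ y in 𝓝 (f x), ∃ u ∈ V, f u = y := fun x hx ↦
    nhds_le_map_nhds_of_injOn hV hf hg.injOn hx (image_mem_map (hV.mem_nhds hx))
  -- Where `f' ≠ 0` this is the inverse function theorem. Zeros of `f'` are isolated, since `f` is
  -- injective, so a possible one is a removable singularity of the continuous map `g`.
  have hreg : ∀ x ∈ V, deriv f x ≠ 0 → DifferentiableAt ℂ g (f x) := by
    intro x hx hd
    have hda : HasDerivAt f (deriv f x) (g (f x)) := by
      rw [hg hx]
      exact (hf.differentiableAt (hV.mem_nhds hx)).hasDerivAt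
    refine (HasDerivAt.of_local_left_inverse (continuousAt_of_leftInvOn hV hf hg hx) hda hd
      ?_).differentiableAt
    filter_upwards [hopen x hx] with y hy
    obtain ⟨u, hu, rfl⟩ := hy
    rw [hg hu]
  have hne : ∀ᶠ x in 𝓝[≠] z, deriv f x ≠ 0 := by
    refine ((hf.analyticAt (hV.mem_nhds hz)).deriv.eventually_eq_zero_or_eventually_ne_zero
      ).resolve_left ?_
    intro h0
    obtain ⟨r, hr, hball⟩ := Metric.eventually_nhds_iff_ball.1
      (h0.and (hV.mem_nhds hz : ∀ᶠ w in 𝓝 z, w ∈ V))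
    have hmem : z + (r / 2 : ℝ) ∈ Metric.ball z r := by
      rw [Metric.mem_ball, dist_eq_norm, add_sub_cancel_left, Complex.norm_real, Real.norm_eq_abs,
        abs_of_pos (by positivity)]
      linarith
    have hconst := Metric.isOpen_ball.is_const_of_deriv_eq_zero
      (convex_ball z r).isPreconnected
      (hf.mono fun w hw ↦ (hball w hw).2) (fun w hw ↦ (hball w hw).1) hmem
      (Metric.mem_ball_self hr)
    have := hg.injOn (hball _ hmem).2 hz hconst
    have h3 : ((r / 2 : ℝ) : ℂ) = 0 := by simpa using this
    have h4 := Complex.ofReal_eq_zero.1 h3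
    linarith
  refine (Complex.analyticAt_of_differentiable_on_punctured_nhds_of_continuousAt ?_
    hcont).differentiableAt
  have htend : Tendsto g (𝓝[≠] (f z)) (𝓝[≠] z) := by
    refine tendsto_nhdsWithin_iff.2 ⟨?_, ?_⟩
    · have := hcont.tendsto
      rw [hg hz] at this
      exact this.mono_left nhdsWithin_le_nhds
    · filter_upwards [(hopen z hz).filter_mono nhdsWithin_le_nhds, self_mem_nhdsWithin] with y hy hyz
      obtain ⟨u, hu, rfl⟩ := hy
      rw [hg hu]
      rintro rfl
      exact hyz rfl
  filter_upwards [htend.eventually hne, (hopen z hz).filter_mono nhdsWithin_le_nhds] with y hy hyo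
  obtain ⟨u, hu, rfl⟩ := hyo
  rw [hg hu] at hy
  exact hreg u hu hy

theorem deriv_mul_deriv_of_leftInvOn (hV : IsOpen V) (hf : DifferentiableOn ℂ f V)
    (hg : LeftInvOn g f V) {z : ℂ} (hz : z ∈ V) : deriv g (f z) * deriv f z = 1 := by
  have h1 := (differentiableAt_of_leftInvOn hV hf hg hz).hasDerivAt.comp z
    (hf.differentiableAt (hV.mem_nhds hz)).hasDerivAt
  refine h1.unique ((hasDerivAt_id z).congr_of_eventuallyEq ?_)
  filter_upwards [hV.mem_nhds hz] with w hw using hg hw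

end Univalent

/-! ### Bloch's and Koebe's theorems with explicit constants. -/

section Bloch

open Metric

/-- If `|f'| ≤ 2 |f'(a)|` on a disc of radius `s`, then the image of the disc contains a disc of
radius `s |f'(a)| / 24` about `f a`. -/
theorem ball_subset_image_ball_of_norm_deriv_le {f : ℂ → ℂ} {a : ℂ} {s : ℝ} (hs : 0 < s)
    (hf : DifferentiableOn ℂ f (ball a s)) (hb : ∀ x ∈ ball a s, ‖deriv f x‖ ≤ 2 * ‖deriv f a‖) :
    ball (f a) (s * ‖deriv f a‖ / 24) ⊆ f '' ball a s := by
  set m := ‖deriv f a‖ with hm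
  have hd : DifferentiableOn ℂ (deriv f) (ball a s) := hf.deriv isOpen_ball
  have hmaps : MapsTo (deriv f) (ball a s) (closedBall (deriv f a) (3 * m)) := by
    intro x hx
    rw [mem_closedBall, dist_eq_norm]
    calc ‖deriv f x - deriv f a‖ ≤ ‖deriv f x‖ + ‖deriv f a‖ := norm_sub_le _ _
      _ ≤ 3 * m := by linarith [hb x hx]
  have hsub : closedBall a (s / 6) ⊆ ball a s := closedBall_subset_ball (by linarith)
  -- Schwarz lemma for `f'`; the radius `s / 6` makes the bound half of `|f'(a)|`, so the linear
  -- part of `f` dominates.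
  have hlip : ∀ x ∈ closedBall a (s / 6), ‖deriv f x - deriv f a‖ ≤ m / 2 := by
    intro x hx
    have h1 := Complex.dist_le_div_mul_dist_of_mapsTo_ball hd hmaps (hsub hx)
    rw [dist_eq_norm] at h1
    refine h1.trans ?_
    have hx' : dist x a ≤ s / 6 := hx
    calc 3 * m / s * dist x a ≤ 3 * m / s * (s / 6) := by gcongr
      _ = m / 2 := by field_simp; ring
  have hmv : ∀ x ∈ closedBall a (s / 6), ‖(f x - deriv f a * x) - (f a - deriv f a * a)‖
      ≤ m / 2 * ‖x - a‖ := by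
    intro x hx
    refine (convex_closedBall a (s / 6)).norm_image_sub_le_of_norm_hasDerivWithin_le
      (f := fun y ↦ f y - deriv f a * y) (f' := fun y ↦ deriv f y - deriv f a) ?_ hlip
      (mem_closedBall_self (by positivity)) hx
    intro y hy
    have h1 := (hf.differentiableAt (isOpen_ball.mem_nhds (hsub hy))).hasDerivAt
    have h2 : HasDerivAt (fun y ↦ deriv f a * y) (deriv f a) y := by
      simpa using (hasDerivAt_id y).const_mul (deriv f a)
    exact (h1.sub h2).hasDerivWithinAt
  have hsph : ∀ x ∈ sphere a (s / 6), s * m / 12 ≤ ‖f x - f a‖ := by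
    intro x hx
    have hxn : ‖x - a‖ = s / 6 := by simpa [dist_eq_norm] using hx
    have h1 := hmv x (sphere_subset_closedBall hx)
    have h2 : deriv f a * (x - a) = (f x - f a) -
      ((f x - deriv f a * x) - (f a - deriv f a * a)) := by ring
    have h3 := congrArg norm h2
    rw [norm_mul, hxn, ← hm] at h3
    have h4 := norm_sub_le (f x - f a) ((f x - deriv f a * x) - (f a - deriv f a * a))
    rw [hxn] at h1
    linarith
  rcases (norm_nonneg (deriv f a)).eq_or_lt with h0 | h0
  · rw [hm, ← h0]; simp
  have hdc : DiffContOnCl ℂ f (ball a (s / 6)) := (hf.mono hsub).diffContOnCl_ball subset_rfl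
  have hnc : ∃ᶠ z in 𝓝 a, f z ≠ f a := by
    intro hc
    have hc' : f =ᶠ[𝓝 a] fun _ ↦ f a := by
      filter_upwards [hc] with z hz
      simpa using hz
    have := hc'.deriv_eq
    simp [deriv_const] at this
    rw [this] at h0
    simp at h0
  refine (subset_trans (ball_subset_ball (le_of_eq ?_))
    (hdc.ball_subset_image_closedBall (by positivity) hsph hnc)).trans (image_mono hsub)
  ring

/-- **Bloch's theorem**, with a non-optimal constant. -/
theorem exists_ball_subset_image_ball {f : ℂ → ℂ} {z : ℂ} {r : ℝ} (hr : 0 < r)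
    (hf : DifferentiableOn ℂ f (ball z r)) :
    ∃ c, ball c (r * ‖deriv f z‖ / 96) ⊆ f '' ball z r := by
  have hsub : closedBall z (r / 2) ⊆ ball z r := closedBall_subset_ball (by linarith)
  have hd : DifferentiableOn ℂ (deriv f) (ball z r) := hf.deriv isOpen_ball
  -- Maximality of this weighted derivative at `a` gives `|f'| ≤ 2 |f'(a)|` on the disc about `a` of
  -- radius half the weight.
  obtain ⟨a, ha, hmax⟩ := (isCompact_closedBall z (r / 2)).exists_isMaxOn
    (f := fun x ↦ (r / 2 - dist x z) * ‖deriv f x‖) ⟨z, mem_closedBall_self (by positivity)⟩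
    ((by fun_prop : Continuous fun x ↦ r / 2 - dist x z).continuousOn.mul
      (hd.continuousOn.mono hsub).norm)
  have hmz : r / 2 * ‖deriv f z‖ ≤ (r / 2 - dist a z) * ‖deriv f a‖ := by
    simpa using hmax (mem_closedBall_self (by positivity) : z ∈ closedBall z (r / 2))
  rcases (norm_nonneg (deriv f z)).eq_or_lt with h0 | h0
  · exact ⟨0, by simp [← h0]⟩
  have hpos : 0 < (r / 2 - dist a z) * ‖deriv f a‖ := lt_of_lt_of_le (by positivity) hmz
  have ha' : dist a z ≤ r / 2 := ha
  have hs : 0 < r / 2 - dist a z := pos_of_mul_pos_left hpos (norm_nonneg _)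
  set s := r / 2 - dist a z with hsdef
  have hin : ∀ x ∈ ball a (s / 2), dist x z ≤ r / 2 - s / 2 := by
    intro x hx
    have h1 : dist x a < s / 2 := hx
    linarith [dist_triangle x a z]
  have hsub2 : ball a (s / 2) ⊆ ball z r := fun x hx ↦ by
    rw [mem_ball]; linarith [hin x hx]
  have hb : ∀ x ∈ ball a (s / 2), ‖deriv f x‖ ≤ 2 * ‖deriv f a‖ := by
    intro x hx
    have h1 := hin x hx
    have h2 : (r / 2 - dist x z) * ‖deriv f x‖ ≤ s * ‖deriv f a‖ :=
      hmax (show x ∈ closedBall z (r / 2) by rw [mem_closedBall]; linarith)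
    have h3 : s / 2 * ‖deriv f x‖ ≤ s * ‖deriv f a‖ :=
      le_trans (by gcongr; linarith) h2
    nlinarith
  refine ⟨f a, (subset_trans (ball_subset_ball ?_)
    (ball_subset_image_ball_of_norm_deriv_le (by positivity) (hf.mono hsub2) hb)).trans
    (image_mono hsub2)⟩
  linarith

/-- **Koebe's theorem**, with a non-optimal constant. -/
theorem ball_subset_image_ball_of_injOn {f : ℂ → ℂ} {z : ℂ} {r : ℝ}
    (hf : DifferentiableOn ℂ f (ball z r)) (hi : InjOn f (ball z r)) :
    ball (f z) (r * ‖deriv f z‖ / 400) ⊆ f '' ball z r := by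
  intro w hw
  by_contra hwn
  have hrm : 0 < r * ‖deriv f z‖ := by
    have := dist_nonneg.trans_lt (mem_ball.1 hw)
    linarith
  have hr : 0 < r := pos_of_mul_pos_left hrm (norm_nonneg _)
  have hz : z ∈ ball z r := mem_ball_self hr
  have hne : ∀ x ∈ ball z r, f x - w ≠ 0 := fun x hx h ↦
    hwn ⟨x, hx, sub_eq_zero.1 h⟩
  have hd : DifferentiableOn ℂ (deriv f) (ball z r) := hf.deriv isOpen_ball
  -- `L` is a branch of `log (f - w)` up to a constant. If `w` is too close to `f z`, then `|L'(z)|`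
  -- is so large that Bloch's disc contains two points `2πi` apart, where `f` takes the same value.
  obtain ⟨L, hL⟩ := (hd.div (hf.sub_const w) hne).isExactOn_ball
  have hL' : ∀ x ∈ ball z r, HasDerivAt L (deriv f x / (f x - w)) x := hL
  have hLd : DifferentiableOn ℂ L (ball z r) := fun x hx ↦
    (hL' x hx).differentiableAt.differentiableWithinAt
  have hexp : ∀ x ∈ ball z r, (f x - w) * Complex.exp (-L x) =
      (f z - w) * Complex.exp (-L z) := by
    intro x hx
    have hda : ∀ y ∈ ball z r,
        HasDerivAt (fun y ↦ (f y - w) * Complex.exp (-L y)) 0 y := by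
      intro y hy
      have h1 := ((hf.differentiableAt (isOpen_ball.mem_nhds hy)).hasDerivAt.sub_const w).mul
        (hL' y hy).neg.cexp
      refine h1.congr_deriv ?_
      have := hne y hy
      field_simp
      ring
    exact isOpen_ball.is_const_of_deriv_eq_zero (convex_ball z r).isPreconnected
      (fun y hy ↦ (hda y hy).differentiableAt.differentiableWithinAt)
      (fun y hy ↦ (hda y hy).deriv) hx hz
  obtain ⟨c, hc⟩ := exists_ball_subset_image_ball hr hLd
  have hbig : 4 < r * ‖deriv L z‖ / 96 := by
    rw [(hL' z hz).deriv, norm_div]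
    have h1 : ‖f z - w‖ < r * ‖deriv f z‖ / 400 := by
      simpa [dist_eq_norm, norm_sub_rev] using hw
    have h2 : 0 < ‖f z - w‖ := norm_pos_iff.2 (hne z hz)
    rw [lt_div_iff₀ (by norm_num), ← mul_div_assoc, lt_div_iff₀ h2]
    linarith
  have hπ : ‖(Real.pi : ℂ) * Complex.I‖ < 4 := by
    rw [norm_mul, Complex.norm_I, mul_one, Complex.norm_real, Real.norm_eq_abs,
      abs_of_pos Real.pi_pos]
    exact Real.pi_lt_four
  obtain ⟨x, hx, hxe⟩ := hc (show c + Real.pi * Complex.I ∈ _ by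
    rw [mem_ball, dist_eq_norm, add_sub_cancel_left]; linarith)
  obtain ⟨y, hy, hye⟩ := hc (show c - Real.pi * Complex.I ∈ _ by
    rw [mem_ball, dist_eq_norm, sub_sub_cancel_left, norm_neg]; linarith)
  have hxy : L x = L y + 2 * Real.pi * Complex.I := by rw [hxe, hye]; ring
  have h1 := (hexp x hx).trans (hexp y hy).symm
  rw [hxy, neg_add, Complex.exp_add, Complex.exp_neg (2 * Real.pi * Complex.I),
    Complex.exp_two_pi_mul_I, inv_one, mul_one] at h1
  have h2 := mul_right_cancel₀ (Complex.exp_ne_zero _) h1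
  have h3 := hi hx hy (sub_left_injective h2)
  rw [h3] at hxy
  have : (2 : ℂ) * Real.pi * Complex.I = 0 := by simpa using hxy.symm
  simp [Real.pi_ne_zero] at this

end Bloch

/-! ### Schwarz–Pick on the half plane and its limits at infinity. -/

section SchwarzPick

open ComplexConjugate

/-- The **Schwarz–Pick lemma** on the upper half plane. -/
theorem schwarzPick_of_im_pos {h : ℂ → ℂ} (hd : DifferentiableOn ℂ h upperHalfPlaneSet)
    (hp : ∀ w ∈ upperHalfPlaneSet, 0 < (h w).im) {a w : ℂ} (ha : 0 < a.im) (hw : 0 < w.im) :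
    Complex.normSq (h w - h a) * (w.im * a.im) ≤
      Complex.normSq (w - a) * ((h w).im * (h a).im) := by
  have hns : ∀ x y : ℂ, Complex.normSq (x - conj y) = Complex.normSq (x - y) + 4 * (x.im * y.im) :=
    fun x y ↦ by simp [Complex.normSq_apply]; ring
  have hne : ∀ x y : ℂ, 0 < x.im → 0 < y.im → x - conj y ≠ 0 := by
    intro x y hx hy h0
    have := congrArg Complex.im h0
    simp at this
    linarith
  -- Cayley map from the disc with `C 0 = a`; conjugating `h` by Cayley maps reduces to the Schwarz
  -- lemma at `0`.
  set C : ℂ → ℂ := fun ζ ↦ (a - conj a * ζ) / (1 - ζ) with hC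
  have h1 : ∀ ζ ∈ Metric.ball (0 : ℂ) 1, 1 - ζ ≠ 0 := by
    intro ζ hζ h0
    rw [← sub_eq_zero.1 h0] at hζ
    simp at hζ
  have hCm : MapsTo C (Metric.ball 0 1) upperHalfPlaneSet := by
    intro ζ hζ
    have h2 : 0 < Complex.normSq (1 - ζ) := Complex.normSq_pos.2 (h1 ζ hζ)
    have h3 : Complex.normSq ζ < 1 := by
      rw [Complex.normSq_eq_norm_sq]
      have : ‖ζ‖ < 1 := by simpa using hζ
      nlinarith [norm_nonneg ζ]
    have h4 : (C ζ).im = a.im * (1 - Complex.normSq ζ) / Complex.normSq (1 - ζ) := by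
      simp only [hC, Complex.div_im, ← sub_div]
      congr 1
      simp [Complex.normSq_apply]
      ring
    change 0 < (C ζ).im
    rw [h4]
    exact div_pos (mul_pos ha (by linarith)) h2
  set k : ℂ → ℂ := fun ζ ↦ (h (C ζ) - h a) / (h (C ζ) - conj (h a)) with hk
  have hkd : DifferentiableOn ℂ k (Metric.ball 0 1) := by
    have hCd : DifferentiableOn ℂ C (Metric.ball 0 1) := by
      refine DifferentiableOn.div (by fun_prop) (by fun_prop) h1
    have := hd.comp hCd hCm
    exact (this.sub_const _).div (this.sub_const _) fun ζ hζ ↦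
      hne _ _ (hp _ (hCm hζ)) (hp _ ha)
  have hkm : MapsTo k (Metric.ball 0 1) (Metric.closedBall 0 1) := by
    intro ζ hζ
    have h5 := hp _ (hCm hζ)
    have h6 := hp _ ha
    have h7 := hne _ _ h5 h6
    simp only [hk, mem_closedBall_zero_iff, norm_div]
    rw [div_le_one (norm_pos_iff.2 h7), ← sq_le_sq₀ (norm_nonneg _) (norm_nonneg _),
      ← Complex.normSq_eq_norm_sq, ← Complex.normSq_eq_norm_sq, hns]
    have := mul_pos h5 h6
    linarith
  have hk0 : k 0 = 0 := by simp [hk, hC]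
  have hwa := hne w a hw ha
  have hζ : ‖(w - a) / (w - conj a)‖ < 1 := by
    rw [norm_div, div_lt_one (norm_pos_iff.2 hwa), ← sq_lt_sq₀ (norm_nonneg _) (norm_nonneg _),
      ← Complex.normSq_eq_norm_sq, ← Complex.normSq_eq_norm_sq, hns]
    have := mul_pos hw ha
    linarith
  have hCw : C ((w - a) / (w - conj a)) = w := by
    have h8 : a - conj a ≠ 0 := hne a a ha ha
    have h9 : 1 - (w - a) / (w - conj a) = (a - conj a) / (w - conj a) := by
      field_simp
      ring
    simp only [hC]
    rw [h9]
    field_simp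
    ring
  have hfin := Complex.norm_le_norm_of_mapsTo_ball hkd hkm hk0 hζ
  simp only [hk, hCw, norm_div] at hfin
  have hhw := hne _ _ (hp w hw) (hp a ha)
  rw [div_le_div_iff₀ (norm_pos_iff.2 hhw) (norm_pos_iff.2 hwa),
    ← sq_le_sq₀ (by positivity) (by positivity), mul_pow, mul_pow] at hfin
  simp only [← Complex.normSq_eq_norm_sq, hns] at hfin
  linarith

/-- Apply the strict case to `h + iη` and let `η → 0`. The weak form is needed for `f - id`, which
vanishes when `f` is the identity. -/
theorem schwarzPick_of_im_nonneg {h : ℂ → ℂ} (hd : DifferentiableOn ℂ h upperHalfPlaneSet)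
    (hp : ∀ w ∈ upperHalfPlaneSet, 0 ≤ (h w).im) {a w : ℂ} (ha : 0 < a.im) (hw : 0 < w.im) :
    Complex.normSq (h w - h a) * (w.im * a.im) ≤
      Complex.normSq (w - a) * ((h w).im * (h a).im) := by
  have h1 : ∀ η : ℝ, 0 < η → Complex.normSq (h w - h a) * (w.im * a.im) ≤
      Complex.normSq (w - a) * (((h w).im + η) * ((h a).im + η)) := by
    intro η hη
    have := schwarzPick_of_im_pos (h := fun z ↦ h z + η * Complex.I) (hd.add_const _)
      (fun z hz ↦ by have := hp z hz; simp; linarith) ha hw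
    simpa using this
  have h2 : Tendsto (fun η : ℝ ↦ Complex.normSq (w - a) * (((h w).im + η) * ((h a).im + η)))
      (𝓝[>] 0) (𝓝 (Complex.normSq (w - a) * (((h w).im + 0) * ((h a).im + 0)))) :=
    ((by fun_prop : Continuous fun η : ℝ ↦
      Complex.normSq (w - a) * (((h w).im + η) * ((h a).im + η))).tendsto 0).mono_left
      nhdsWithin_le_nhds
  have := ge_of_tendsto h2 (eventually_mem_nhdsWithin.mono fun η hη ↦ h1 η hη)
  simpa using this

theorem tendsto_div_ofReal_atTop (w : ℂ) : Tendsto (fun y : ℝ ↦ w / (y : ℂ)) atTop (𝓝 0) := by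
  have h1 : Tendsto (fun y : ℝ ↦ ((y⁻¹ : ℝ) : ℂ)) atTop (𝓝 ((0 : ℝ) : ℂ)) :=
    (Complex.continuous_ofReal.tendsto 0).comp tendsto_inv_atTop_zero
  simpa [div_eq_mul_inv] using h1.const_mul w

/-- **Julia's lemma** at `∞`, for angular derivative `1`. -/
theorem im_le_im_of_tendsto {f : ℂ → ℂ} (hd : DifferentiableOn ℂ f upperHalfPlaneSet)
    (hp : ∀ w ∈ upperHalfPlaneSet, 0 ≤ (f w).im)
    (hlim : Tendsto (fun y : ℝ ↦ f (y * Complex.I) - y * Complex.I) atTop (𝓝 0))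
    {w : ℂ} (hw : 0 < w.im) : w.im ≤ (f w).im := by
  have hf : Tendsto (fun y : ℝ ↦ f (y * Complex.I) / y) atTop (𝓝 Complex.I) := by
    have h1 := (hlim.mul (tendsto_div_ofReal_atTop 1)).add_const Complex.I
    rw [zero_mul, zero_add] at h1
    refine h1.congr' ?_
    filter_upwards [eventually_gt_atTop 0] with y hy
    have : (y : ℂ) ≠ 0 := by exact_mod_cast hy.ne'
    field_simp
    ring
  have hL : Tendsto (fun y : ℝ ↦ Complex.normSq (f w / y - f (y * Complex.I) / y) * w.im) atTop
      (𝓝 (Complex.normSq (0 - Complex.I) * w.im)) :=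
    ((Complex.continuous_normSq.tendsto _).comp
      ((tendsto_div_ofReal_atTop (f w)).sub hf)).mul_const _
  have hR : Tendsto (fun y : ℝ ↦ Complex.normSq (w / y - Complex.I) *
      ((f w).im * (f (y * Complex.I) / y).im)) atTop
      (𝓝 (Complex.normSq (0 - Complex.I) * ((f w).im * Complex.I.im))) :=
    ((Complex.continuous_normSq.tendsto _).comp
      ((tendsto_div_ofReal_atTop w).sub_const _)).mul
      (((Complex.continuous_im.tendsto _).comp hf).const_mul _)
  have hle := le_of_tendsto_of_tendsto hL hR ?_
  · simpa using hle
  filter_upwards [eventually_gt_atTop 0] with y hy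
  have hyc : (y : ℂ) ≠ 0 := by exact_mod_cast hy.ne'
  have h1 := schwarzPick_of_im_nonneg hd hp (a := y * Complex.I) (by simpa using hy) hw
  have h2 : f w / y - f (y * Complex.I) / y = (f w - f (y * Complex.I)) / y := by ring
  have h3 : w / y - Complex.I = (w - y * Complex.I) / y := by field_simp
  rw [h2, h3, Complex.normSq_div, Complex.normSq_div, Complex.normSq_ofReal, Complex.div_ofReal_im]
  simp only [Complex.mul_im, Complex.ofReal_re, Complex.I_im, mul_one, Complex.ofReal_im,
    Complex.I_re, mul_zero, add_zero] at h1
  rw [← sub_nonneg] at h1 ⊢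
  -- Schwarz–Pick between `w` and `iy`, rescaled by `y ^ 3` so that both sides converge.
  have h4 := div_nonneg h1 (by positivity : 0 ≤ y ^ 3)
  convert h4 using 1
  field_simp

/-- A holomorphic self-map `q` of the upper half plane with `z q(z) → -a` along the imaginary axis
satisfies `|q(w)| ≤ a / Im w`. -/
theorem norm_mul_im_le_of_tendsto {q : ℂ → ℂ} {a : ℝ} (ha : 0 ≤ a)
    (hd : DifferentiableOn ℂ q upperHalfPlaneSet) (hp : ∀ w ∈ upperHalfPlaneSet, 0 ≤ (q w).im)
    (hlim : Tendsto (fun y : ℝ ↦ y * Complex.I * q (y * Complex.I)) atTop (𝓝 (-a)))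
    {w : ℂ} (hw : 0 < w.im) : ‖q w‖ * w.im ≤ a := by
  have hyq : Tendsto (fun y : ℝ ↦ y * q (y * Complex.I)) atTop (𝓝 (a * Complex.I)) := by
    have h1 := hlim.const_mul (-Complex.I)
    have e : -Complex.I * -(a : ℂ) = a * Complex.I := by ring
    rw [e] at h1
    refine h1.congr fun y ↦ ?_
    linear_combination (-(y : ℂ) * q (y * Complex.I)) * Complex.I_mul_I
  have hq : Tendsto (fun y : ℝ ↦ q (y * Complex.I)) atTop (𝓝 0) := by
    have h1 := hyq.mul (tendsto_div_ofReal_atTop 1)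
    rw [mul_zero] at h1
    refine h1.congr' ?_
    filter_upwards [eventually_gt_atTop 0] with y hy
    have : (y : ℂ) ≠ 0 := by exact_mod_cast hy.ne'
    field_simp
  have hL : Tendsto (fun y : ℝ ↦ Complex.normSq (q w - q (y * Complex.I)) * w.im) atTop
      (𝓝 (Complex.normSq (q w - 0) * w.im)) :=
    ((Complex.continuous_normSq.tendsto _).comp (hq.const_sub _)).mul_const _
  have hR : Tendsto (fun y : ℝ ↦ Complex.normSq (w / y - Complex.I) *
      ((q w).im * (y * q (y * Complex.I)).im)) atTop
      (𝓝 (Complex.normSq (0 - Complex.I) * ((q w).im * (a * Complex.I).im))) :=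
    ((Complex.continuous_normSq.tendsto _).comp
      ((tendsto_div_ofReal_atTop w).sub_const _)).mul
      (((Complex.continuous_im.tendsto _).comp hyq).const_mul _)
  have hle := le_of_tendsto_of_tendsto hL hR ?_
  -- The limit of Schwarz–Pick; bounding `Im q` by `|q|` and cancelling one factor `|q|` gives the
  -- claim.
  · have h1 : Complex.normSq (q w) * w.im ≤ (q w).im * a := by simpa using hle
    rw [Complex.normSq_eq_norm_sq] at h1
    have h2 : (q w).im ≤ ‖q w‖ := (le_abs_self _).trans (Complex.abs_im_le_norm _)
    rcases (norm_nonneg (q w)).eq_or_lt with h0 | h0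
    · rw [← h0]; simpa using ha
    · have h3 : ‖q w‖ * (‖q w‖ * w.im) ≤ ‖q w‖ * a :=
        calc ‖q w‖ * (‖q w‖ * w.im) = ‖q w‖ ^ 2 * w.im := by ring
          _ ≤ (q w).im * a := h1
          _ ≤ ‖q w‖ * a := by gcongr
      exact le_of_mul_le_mul_left h3 h0
  filter_upwards [eventually_gt_atTop 0] with y hy
  have hyc : (y : ℂ) ≠ 0 := by exact_mod_cast hy.ne'
  have h1 := schwarzPick_of_im_nonneg hd hp (a := y * Complex.I) (by simpa using hy) hw
  have h3 : w / y - Complex.I = (w - y * Complex.I) / y := by field_simp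
  rw [h3, Complex.normSq_div, Complex.normSq_ofReal, Complex.im_ofReal_mul]
  simp only [Complex.mul_im, Complex.ofReal_re, Complex.I_im, mul_one, Complex.ofReal_im,
    Complex.I_re, mul_zero, add_zero] at h1
  rw [← sub_nonneg] at h1 ⊢
  have h4 := div_nonneg h1 hy.le
  convert h4 using 1
  field_simp

end SchwarzPick

/-! ### Distortion of the inner radius under conformal maps. -/

section Conformal

variable {V W : Set ℂ} {f g : ℂ → ℂ}

theorem IsConformalMapOnto.exists_inverse (hV : IsOpen V) (hf : IsConformalMapOnto f V W) :
    ∃ g, IsConformalMapOnto g W V ∧ InvOn g f V W := by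
  have hinv := hf.2.invOn_invFunOn
  refine ⟨Function.invFunOn f V, ⟨?_, hf.2.symm hinv.symm⟩, hinv⟩
  intro w hw
  obtain ⟨z, hz, rfl⟩ := hf.2.surjOn hw
  exact (differentiableAt_of_leftInvOn hV hf.1 hinv.1 hz).differentiableWithinAt

theorem IsConformalMapOnto.comp {U : Set ℂ} (hg : IsConformalMapOnto g V W)
    (hf : IsConformalMapOnto f U V) : IsConformalMapOnto (g ∘ f) U W :=
  ⟨hg.1.comp hf.1 hf.2.mapsTo, hg.2.comp hf.2⟩

theorem le_innerRadius {p : ℂ} {r : ℝ} (hV : V ≠ univ) (h : Metric.ball p r ⊆ V) :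
    r ≤ innerRadius V p := by
  refine (Metric.le_infDist (nonempty_compl.2 hV)).2 fun y hy ↦ ?_
  by_contra hlt
  rw [not_le, dist_comm] at hlt
  exact hy (h hlt)

theorem ball_innerRadius_subset (p : ℂ) : Metric.ball p (innerRadius V p) ⊆ V :=
  Metric.ball_infDist_compl_subset

theorem ball_im_subset_upperHalfPlaneSet (z : ℂ) : Metric.ball z z.im ⊆ upperHalfPlaneSet := by
  intro w hw
  have h1 : ‖z - w‖ < z.im := by simpa [dist_eq_norm, norm_sub_rev] using hw
  have h2 := (le_abs_self _).trans (Complex.abs_im_le_norm (z - w))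
  change 0 < w.im
  rw [Complex.sub_im] at h2
  linarith

theorem IsConformalMapOnto.im_mul_norm_deriv_le_innerRadius (hV : V ≠ univ)
    (hf : IsConformalMapOnto f upperHalfPlaneSet V) (z : ℂ) :
    z.im * ‖deriv f z‖ / 400 ≤ innerRadius V (f z) := by
  have hsub := ball_im_subset_upperHalfPlaneSet z
  exact le_innerRadius hV ((ball_subset_image_ball_of_injOn (hf.1.mono hsub)
    (hf.2.injOn.mono hsub)).trans ((image_mono hsub).trans hf.2.image_eq.subset))

theorem IsConformalMapOnto.innerRadius_mul_norm_deriv_le_im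
    (hf : IsConformalMapOnto f V upperHalfPlaneSet) {p : ℂ} (hp : p ∈ V) :
    innerRadius V p * ‖deriv f p‖ / 400 ≤ (f p).im := by
  have hsub := ball_innerRadius_subset (V := V) p
  have h1 := (ball_subset_image_ball_of_injOn (hf.1.mono hsub)
    (hf.2.injOn.mono hsub)).trans ((image_mono hsub).trans hf.2.image_eq.subset)
  have him : 0 < (f p).im := hf.2.mapsTo hp
  by_contra! hlt
  have h2 : 0 < (f p - (f p).im * Complex.I).im := h1 (by
    rw [Metric.mem_ball, dist_eq_norm, sub_sub_cancel_left, norm_neg, norm_mul, Complex.norm_I,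
      Complex.norm_real, Real.norm_eq_abs, abs_of_pos him, mul_one]
    exact hlt)
  simp at h2

/-- Under a conformal map of the upper half plane, the inner radius at most halves over a small
hyperbolic distance. -/
theorem IsConformalMapOnto.innerRadius_div_two_le (hV : V ≠ univ)
    (hf : IsConformalMapOnto f upperHalfPlaneSet V) {z w : ℂ} (hz : 0 < z.im)
    (hzw : dist w z < z.im / 320000) : innerRadius V (f z) / 2 ≤ innerRadius V (f w) := by
  obtain ⟨g, hg, hinv⟩ := hf.exists_inverse UpperHalfPlane.isOpen_upperHalfPlaneSet
  set ρ := innerRadius V (f z) with hρ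
  have hρ0 : 0 ≤ ρ := Metric.infDist_nonneg
  have hprod := deriv_mul_deriv_of_leftInvOn UpperHalfPlane.isOpen_upperHalfPlaneSet hf.1
    hinv.1 (z := z) hz
  have hprodn : ‖deriv g (f z)‖ * ‖deriv f z‖ = 1 := by rw [← norm_mul, hprod, norm_one]
  have h1 : z.im * ‖deriv f z‖ / 400 ≤ ρ := hf.im_mul_norm_deriv_le_innerRadius hV z
  have hsub : Metric.ball (f z) (ρ / 2) ⊆ V :=
    (Metric.ball_subset_ball (by linarith :
      ρ / 2 ≤ ρ)).trans (ball_innerRadius_subset _)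
  have h2 := ball_subset_image_ball_of_injOn (hg.1.mono hsub) (hg.2.injOn.mono hsub)
  rw [hinv.1 hz] at h2
  -- `320000 = 2 * 400 * 400`: Koebe once for `f` and once for its inverse on the disc of radius `ρ
  -- / 2`.
  have h3 : z.im / 320000 ≤ ρ / 2 * ‖deriv g (f z)‖ / 400 := by
    have := mul_le_mul_of_nonneg_right h1 (norm_nonneg (deriv g (f z)))
    have e : z.im * ‖deriv f z‖ / 400 * ‖deriv g (f z)‖ = z.im / 400 := by
      linear_combination (z.im / 400) * hprodn
    linarith
  obtain ⟨u, hu, rfl⟩ := h2 (show w ∈ _ from lt_of_lt_of_le hzw h3)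
  rw [hinv.2 (hsub hu)]
  have h4 : ρ ≤ innerRadius V u + dist (f z) u := Metric.infDist_le_infDist_add_dist
  have h5 : dist u (f z) < ρ / 2 := hu
  rw [dist_comm] at h5
  linarith

/-- Cut the segment from `z` to `w` into `N` equal steps. Heights along it stay at least `1`, so
each step is short enough to lose only a factor `2`. -/
theorem IsConformalMapOnto.half_pow_mul_innerRadius_le (hV : V ≠ univ)
    (hf : IsConformalMapOnto f upperHalfPlaneSet V) {N : ℕ} {z w : ℂ} (hz : 1 ≤ z.im)
    (hw : 1 ≤ w.im) (hzw : 320000 * dist z w < N) :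
    (1 / 2) ^ N * innerRadius V (f z) ≤ innerRadius V (f w) := by
  have hN : (0 : ℝ) < N := lt_of_le_of_lt (by positivity) hzw
  set c : ℕ → ℂ := fun k ↦ z + ((k / N : ℝ) : ℂ) * (w - z) with hc
  have hstep : ∀ k ≤ N, (1 / 2) ^ k * innerRadius V (f z) ≤ innerRadius V (f (c k)) := by
    intro k
    induction k with
    | zero => simp [hc]
    | succ k ih =>
      intro hk
      have hkN : ((k : ℝ) + 1) ≤ N := by exact_mod_cast hk
      have him : 1 ≤ (c k).im := by
        have h0 : (c k).im = z.im + k / N * (w.im - z.im) := by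
          simp only [hc, Complex.add_im, Complex.im_ofReal_mul, Complex.sub_im]
        have h1 : (k : ℝ) / N ≤ 1 := (div_le_one hN).2 (by linarith)
        have h2 : 0 ≤ (k : ℝ) / N := by positivity
        rw [h0]
        nlinarith
      have hd : dist (c (k + 1)) (c k) < (c k).im / 320000 := by
        have e : c (k + 1) - c k = ((1 / N : ℝ) : ℂ) * (w - z) := by
          simp only [hc]
          push_cast
          ring
        rw [dist_eq_norm, e, norm_mul, Complex.norm_real, Real.norm_eq_abs,
          abs_of_pos (by positivity), ← dist_eq_norm, dist_comm w z]
        calc 1 / N * dist z w < 1 / 320000 := by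
              rw [one_div_mul_eq_div, div_lt_div_iff₀ hN (by norm_num)]
              linarith
          _ ≤ (c k).im / 320000 := by gcongr
      have h1 := hf.innerRadius_div_two_le hV (by linarith) hd
      have h2 := ih (by omega)
      rw [pow_succ]
      linarith
  have h1 := hstep N le_rfl
  have h2 : c N = w := by
    simp only [hc]
    rw [div_self hN.ne']
    simp
  rwa [h2] at h1

end Conformal

/-! ### Control of the inverse mapping-out function by the capacity. -/

section MappingOut

variable {A : Set ℂ} {f g : ℂ → ℂ}

/-- The inverse of a mapping-out function of a bounded set is close to the identity at `∞`. -/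
theorem IsMappingOut.exists_norm_inverse_sub_le (hg : IsMappingOut g A)
    (hA : Bornology.IsBounded A) (hf : IsConformalMapOnto f upperHalfPlaneSet (upperHalfPlaneSet \ A))
    (hinv : InvOn f g (upperHalfPlaneSet \ A) upperHalfPlaneSet) :
    ∃ R : ℝ, ∀ w : ℂ, R < w.im → ‖f w - w‖ ≤ 1 := by
  have h1 : ∀ᶠ z in cocompact ℂ, z ∈ upperHalfPlaneSet \ A → ‖g z - z‖ < 1 := by
    have := hg.2.norm.eventually_lt_const (norm_zero (E := ℂ) ▸ one_pos : ‖(0 : ℂ)‖ < 1)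
    rwa [atInftyIn, eventually_inf_principal] at this
  have h2 : ∀ᶠ z in cocompact ℂ, z ∉ A := by
    rw [← Metric.cobounded_eq_cocompact]
    exact Bornology.isBounded_def.1 hA
  have h12 := h1.and h2
  rw [← Metric.cobounded_eq_cocompact] at h12
  obtain ⟨R₀, -, hR₀⟩ := (hasBasis_cobounded_norm (E := ℂ)).eventually_iff.1 h12
  set R := max R₀ 0 with hR
  have hRnn : 0 ≤ R := le_max_right _ _
  have hout : ∀ z : ℂ, R ≤ ‖z‖ → z ∈ upperHalfPlaneSet → z ∈ upperHalfPlaneSet \ A ∧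
      ‖g z - z‖ < 1 := fun z hz hzH ↦ by
    have := hR₀ (show R₀ ≤ ‖z‖ from (le_max_left _ _).trans hz)
    exact ⟨⟨hzH, this.2⟩, this.1 ⟨hzH, this.2⟩⟩
  have hfar : ∀ w ∈ upperHalfPlaneSet, R ≤ ‖f w‖ → ‖f w - w‖ < 1 := by
    intro w hw hfw
    have := (hout (f w) hfw (hf.2.mapsTo hw).1).2
    rwa [hinv.2 hw, norm_sub_rev] at this
  set E : Set ℂ := {w | R + 2 < w.im} with hE
  have hEH : E ⊆ upperHalfPlaneSet := fun w hw ↦ by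
    change 0 < w.im
    have : R + 2 < w.im := hw
    linarith
  have hEn : ∀ w ∈ E, R + 2 < ‖w‖ := fun w hw ↦
    lt_of_lt_of_le hw ((le_abs_self _).trans (Complex.abs_im_le_norm w))
  have hEc : IsPreconnected E := (convex_halfSpace_im_gt (R + 2)).isPreconnected
  set z₀ : ℂ := (R + 4 : ℝ) * Complex.I with hz₀
  have hz₀n : ‖z₀‖ = R + 4 := by
    rw [hz₀, norm_mul, Complex.norm_I, mul_one, Complex.norm_real, Real.norm_eq_abs,
      abs_of_pos (by linarith)]
  have hz₀i : z₀.im = R + 4 := by simp [hz₀]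
  obtain ⟨hz₀A, hz₀g⟩ := hout z₀ (by linarith) (show 0 < z₀.im by linarith)
  have hgz₀ : g z₀ ∈ E := by
    change R + 2 < (g z₀).im
    have := (neg_le_abs _).trans (Complex.abs_im_le_norm (g z₀ - z₀))
    rw [Complex.sub_im] at this
    linarith
  -- It remains to exclude `‖f w‖ < R` at a high `w`. Otherwise, by connectedness of `E`, `‖f‖`
  -- takes the value `R + 1/2` at some `u ∈ E`; then `f u` is within `1` of `u`, although `‖u‖ > R +
  -- 2`.
  refine ⟨R + 2, fun w hw ↦ (hfar w (hEH hw) ?_).le⟩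
  by_contra! hlt
  obtain ⟨u, hu, hun⟩ := hEc.intermediate_value (show w ∈ E from hw) hgz₀
    (f := fun w ↦ ‖f w‖) (hf.1.continuousOn.mono hEH).norm
    (show R + 1 / 2 ∈ Icc ‖f w‖ ‖f (g z₀)‖ by
      rw [hinv.1 hz₀A]
      exact ⟨by linarith, by linarith⟩)
  have hun' : ‖f u‖ = R + 1 / 2 := hun
  have h3 := hfar u (hEH hu) (by linarith)
  have h4 := hEn u hu
  have h5 := norm_sub_norm_le u (f u)
  rw [norm_sub_rev] at h5
  linarith

/-- Lets the normalizations of `g` at infinity be read off along the points `f(iy)`. -/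
theorem IsMappingOut.tendsto_inverse (hg : IsMappingOut g A)
    (hA : Bornology.IsBounded A) (hf : IsConformalMapOnto f upperHalfPlaneSet (upperHalfPlaneSet \ A))
    (hinv : InvOn f g (upperHalfPlaneSet \ A) upperHalfPlaneSet) :
    Tendsto (fun y : ℝ ↦ f (y * Complex.I)) atTop (atInftyIn (upperHalfPlaneSet \ A)) := by
  obtain ⟨R, hR⟩ := hg.exists_norm_inverse_sub_le hA hf hinv
  refine tendsto_inf.2 ⟨?_, tendsto_principal.2 ?_⟩
  · rw [← Metric.cobounded_eq_cocompact, ← tendsto_norm_atTop_iff_cobounded]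
    refine tendsto_atTop_mono' _ ?_ (tendsto_atTop_add_const_right _ (-1 : ℝ) tendsto_id)
    filter_upwards [eventually_gt_atTop R, eventually_gt_atTop 0] with y hy hy0
    have h1 := hR (y * Complex.I) (by simpa using hy)
    have h2 := norm_sub_norm_le (y * Complex.I) (f (y * Complex.I))
    rw [norm_sub_rev, norm_mul, Complex.norm_I, mul_one, Complex.norm_real, Real.norm_eq_abs,
      abs_of_pos hy0] at h2
    simp only [id]
    linarith
  · filter_upwards [eventually_gt_atTop 0] with y hy
    exact hf.2.mapsTo (show 0 < ((y : ℂ) * Complex.I).im by simpa using hy)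

/-- The inverse of the mapping-out function of a bounded set of half-plane capacity `h` increases
imaginary parts and moves `w` by at most `h / Im w`. -/
theorem IsMappingOut.im_le_and_norm_sub_le {h : ℝ} (hh : 0 ≤ h) (hg : IsMappingOut g A)
    (hcap : HasHalfPlaneCapacity g A h) (hA : Bornology.IsBounded A)
    (hf : IsConformalMapOnto f upperHalfPlaneSet (upperHalfPlaneSet \ A))
    (hinv : InvOn f g (upperHalfPlaneSet \ A) upperHalfPlaneSet) {w : ℂ} (hw : 0 < w.im) :
    w.im ≤ (f w).im ∧ ‖f w - w‖ * w.im ≤ h := by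
  have ht := hg.tendsto_inverse hA hf hinv
  have hgf : ∀ᶠ y : ℝ in atTop, g (f (y * Complex.I)) = y * Complex.I := by
    filter_upwards [eventually_gt_atTop 0] with y hy
    exact hinv.2 (show 0 < ((y : ℂ) * Complex.I).im by simpa using hy)
  have h1 : Tendsto (fun y : ℝ ↦ f (y * Complex.I) - y * Complex.I) atTop (𝓝 0) := by
    have := (hg.2.comp ht).neg
    rw [neg_zero] at this
    refine this.congr' ?_
    filter_upwards [hgf] with y hy
    simp [hy]
  have h2 : Tendsto (fun y : ℝ ↦ y * Complex.I * (f (y * Complex.I) - y * Complex.I)) atTop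
      (𝓝 (-h)) := by
    -- With `z = f(iy)` and `g z = iy`, one has `iy (z - iy) = -z (g z - z) - (z - iy) ^ 2`.
    have := (Tendsto.comp hcap ht).neg.sub (h1.mul h1)
    rw [mul_zero, sub_zero] at this
    refine this.congr' ?_
    filter_upwards [hgf] with y hy
    simp only [Function.comp_apply, hy]
    ring
  have him : ∀ w ∈ upperHalfPlaneSet, w.im ≤ (f w).im := fun w hw ↦
    im_le_im_of_tendsto hf.1 (fun z hz ↦ (show 0 < (f z).im from (hf.2.mapsTo hz).1).le) h1 hw
  exact ⟨him w hw, norm_mul_im_le_of_tendsto (q := fun z ↦ f z - z) hh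
    (hf.1.sub differentiableOn_id) (fun z hz ↦ by simpa using him z hz) h2 hw⟩

end MappingOut

/-- A holomorphic map of the upper half plane with `|f(w) - w| ≤ h / Im w` has derivative at
least `1 / 2` in norm high up. -/
theorem half_le_norm_deriv_of_norm_sub_mul_im_le {f : ℂ → ℂ} {h : ℝ}
    (hf : DifferentiableOn ℂ f upperHalfPlaneSet)
    (hb : ∀ w : ℂ, 0 < w.im → ‖f w - w‖ * w.im ≤ h) {z : ℂ} (hz : 0 < z.im)
    (hzh : 16 * h ≤ z.im ^ 2) : 1 / 2 ≤ ‖deriv f z‖ := by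
  have hsub : Metric.ball z (z.im / 2) ⊆ upperHalfPlaneSet :=
    (Metric.ball_subset_ball (by linarith)).trans (ball_im_subset_upperHalfPlaneSet z)
  have hq : ∀ w ∈ Metric.ball z (z.im / 2), ‖f w - w‖ ≤ 2 * h / z.im := by
    intro w hw
    have h1 : ‖z - w‖ < z.im / 2 := by simpa [dist_eq_norm, norm_sub_rev] using hw
    have h2 := (le_abs_self _).trans (Complex.abs_im_le_norm (z - w))
    rw [Complex.sub_im] at h2
    have h3 := hb w (hsub hw)
    rw [le_div_iff₀ hz]
    have h4 : ‖f w - w‖ * (z.im / 2) ≤ ‖f w - w‖ * w.im := by gcongr; linarith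
    linarith
  have hzm : z ∈ Metric.ball z (z.im / 2) := Metric.mem_ball_self (by positivity)
  have hmaps : MapsTo (fun w ↦ f w - w) (Metric.ball z (z.im / 2))
      (Metric.closedBall (f z - z) (4 * h / z.im)) := by
    intro w hw
    rw [Metric.mem_closedBall, dist_eq_norm]
    calc ‖f w - w - (f z - z)‖ ≤ ‖f w - w‖ + ‖f z - z‖ := norm_sub_le _ _
      _ ≤ 2 * h / z.im + 2 * h / z.im := add_le_add (hq w hw) (hq z hzm)
      _ = 4 * h / z.im := by ring
  -- Cauchy's estimate bounds `|f' - 1|` by `8h / (Im z) ^ 2 ≤ 1/2`.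
  have h1 := Complex.norm_deriv_le_div_of_mapsTo_ball (f := fun w ↦ f w - w)
    ((hf.mono hsub).sub differentiableOn_id) hmaps (by positivity)
  have hfz := hf.differentiableAt (UpperHalfPlane.isOpen_upperHalfPlaneSet.mem_nhds hz)
  have hderiv : deriv (fun w ↦ f w - w) z = deriv f z - 1 :=
    (hfz.hasDerivAt.sub (hasDerivAt_id z)).deriv
  rw [hderiv] at h1
  have h2 : 4 * h / z.im / (z.im / 2) ≤ 1 / 2 := by
    rw [div_div, div_le_div_iff₀ (by positivity) (by norm_num)]
    nlinarith
  have h3 := norm_sub_norm_le 1 (deriv f z)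
  rw [norm_sub_rev, norm_one] at h3
  linarith

/-! ### Topology of the hull and of the slit domain. -/

section Chain

variable {D : Set ℂ} {φ : ℂ → ℂ} {S : EReal} {γ : ℝ → ℂ} {g : ℝ → ℂ → ℂ} {U : ℝ → ℝ}

namespace IsChordalLoewnerChain

theorem Ioc_subset {t : ℝ} (htS : (t : EReal) < S) :
    Ioc 0 t ⊆ {s : ℝ | 0 < s ∧ (s : EReal) < S} := fun s hs ↦
  ⟨hs.1, lt_of_le_of_lt (by exact_mod_cast hs.2) htS⟩

/-- Setting the curve to its limit `0` at time `0` makes it continuous on `[0,t]`. As `0` is not in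
the open half plane, the hull is bounded and relatively closed there. -/
theorem isCompact_insert_image (h : IsChordalLoewnerChain D φ S γ g U) {t : ℝ} (ht : 0 ≤ t)
    (htS : (t : EReal) < S) : IsCompact (insert 0 ((fun s ↦ φ (γ s)) '' Ioc 0 t)) := by
  set u : ℝ → ℂ := Function.update (fun s ↦ φ (γ s)) 0 0 with hu
  have hu0 : u 0 = 0 := by simp [hu]
  have hup : ∀ s ∈ Ioc 0 t, u s = φ (γ s) := fun s hs ↦ by simp [hu, hs.1.ne']
  have himg : insert 0 ((fun s ↦ φ (γ s)) '' Ioc 0 t) = u '' Icc 0 t := by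
    rw [← Ioc_insert_left ht, image_insert_eq, hu0]
    congr 1
    exact (image_congr hup).symm
  rw [himg]
  refine isCompact_Icc.image_of_continuousOn fun s hs ↦ ?_
  rcases hs.1.eq_or_lt with rfl | hs0
  · rw [ContinuousWithinAt, hu0]
    have h1 : Tendsto u (𝓝[>] 0) (𝓝 0) :=
      h.start.congr' (eventually_mem_nhdsWithin.mono fun s (hs : 0 < s) ↦ by simp [hu, hs.ne'])
    have h2 : Tendsto u (pure 0) (𝓝 0) := by
      rw [← hu0]
      exact (tendsto_pure_pure u 0).mono_right (pure_le_nhds _)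
    have h3 : 𝓝[Ici (0 : ℝ)] 0 ≤ pure 0 ⊔ 𝓝[>] 0 := by
      rw [← Ioi_insert, nhdsWithin_insert]
    exact (h2.sup h1).mono_left ((nhdsWithin_mono _ Icc_subset_Ici_self).trans h3)
  · have hset : IsOpen {s : ℝ | 0 < s ∧ (s : EReal) < S} :=
      isOpen_Ioi.inter (isOpen_Iio.preimage continuous_coe_real_ereal)
    have hsm := Ioc_subset htS ⟨hs0, hs.2⟩
    have h1 : ContinuousAt (fun s ↦ φ (γ s)) s :=
      ContinuousAt.comp (f := γ)
        ((h.conformal.1.differentiableAt (h.isOpen.mem_nhds (h.mapsTo hsm))).continuousAt)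
        (h.continuousOn.continuousAt (hset.mem_nhds hsm))
    refine (h1.congr ?_).continuousWithinAt
    filter_upwards [isOpen_Ioi.mem_nhds hs0] with r hr
    have hr' : 0 < r := hr
    simp [hu, hr'.ne']

theorem isBounded_image (h : IsChordalLoewnerChain D φ S γ g U) {t : ℝ} (ht : 0 ≤ t)
    (htS : (t : EReal) < S) : Bornology.IsBounded ((fun s ↦ φ (γ s)) '' Ioc 0 t) :=
  (h.isCompact_insert_image ht htS).isBounded.subset (subset_insert _ _)

theorem isOpen_compl_image (h : IsChordalLoewnerChain D φ S γ g U) {t : ℝ} (ht : 0 ≤ t)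
    (htS : (t : EReal) < S) : IsOpen (upperHalfPlaneSet \ (fun s ↦ φ (γ s)) '' Ioc 0 t) := by
  have h1 := UpperHalfPlane.isOpen_upperHalfPlaneSet.sdiff
    (h.isCompact_insert_image ht htS).isClosed
  convert h1 using 1
  ext z
  simp only [Set.mem_sdiff, mem_insert_iff, not_or]
  refine and_congr_right fun hz ↦ (and_iff_right ?_).symm
  rintro rfl
  exact lt_irrefl _ (show 0 < (0 : ℂ).im from hz)

theorem conformal_slitDomain (h : IsChordalLoewnerChain D φ S γ g U) {t : ℝ}
    (htS : (t : EReal) < S) : IsConformalMapOnto φ (slitDomain D γ t)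
      (upperHalfPlaneSet \ (fun s ↦ φ (γ s)) '' Ioc 0 t) := by
  refine ⟨h.conformal.1.mono sdiff_subset, ?_, h.conformal.2.injOn.mono sdiff_subset, ?_⟩
  · rintro z ⟨hzD, hz⟩
    refine ⟨h.conformal.2.mapsTo hzD, ?_⟩
    rintro ⟨s, hs, hsz⟩
    exact hz ⟨s, hs, h.conformal.2.injOn (h.mapsTo (Ioc_subset htS hs)) hzD hsz⟩
  · rintro w ⟨hwH, hw⟩
    obtain ⟨z, hz, rfl⟩ := h.conformal.2.surjOn hwH
    refine ⟨z, ⟨hz, ?_⟩, rfl⟩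
    rintro ⟨s, hs, rfl⟩
    exact hw ⟨s, hs, rfl⟩

end IsChordalLoewnerChain

end Chain

/-! ### Comparison of the inner radii at the reference points. -/

theorem IsReferencePoint.apply_zero {D : Set ℂ} {φ : ℂ → ℂ} {S : EReal} {γ : ℝ → ℂ}
    {g : ℝ → ℂ → ℂ} {U : ℝ → ℝ} {p : ℝ → ℂ} (hp : IsReferencePoint D φ S γ g U p)
    (h : IsChordalLoewnerChain D φ S γ g U) : φ (p 0) = Complex.I := by
  have h0S : ((0 : ℝ) : EReal) < S := by simpa using h.lifetime_pos
  obtain ⟨hp0, hgp⟩ := hp 0 le_rfl h0S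
  have hmo := h.mappingOut 0 le_rfl h0S
  obtain ⟨f, hf, hinv⟩ := hmo.1.exists_inverse (h.isOpen_compl_image le_rfl h0S)
  rw [h.driving_zero, Complex.ofReal_zero, zero_add] at hgp
  have h1 := hinv.1 ((h.conformal_slitDomain h0S).2.mapsTo hp0)
  rw [hgp] at h1
  -- Capacity zero makes the displacement bound zero, so the inverse of `g 0` fixes `i`.
  have h2 := (hmo.im_le_and_norm_sub_le (by norm_num) (h.capacity 0 le_rfl h0S)
    (h.isBounded_image le_rfl h0S) hf hinv (w := Complex.I) (by simp)).2
  have h3 : ‖f Complex.I - Complex.I‖ = 0 := by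
    simp only [Complex.I_im, mul_one, mul_zero] at h2
    exact le_antisymm h2 (norm_nonneg _)
  rw [← h1]
  exact sub_eq_zero.1 (norm_eq_zero.1 h3)

/-- The inner radius at the reference point at a time at most `T` at which `|U| < M`. -/
theorem IsChordalLoewnerChain.mul_innerRadius_le {D : Set ℂ} {φ : ℂ → ℂ} {S : EReal} {γ : ℝ → ℂ}
    {g : ℝ → ℂ → ℂ} {U : ℝ → ℝ} {p : ℝ → ℂ} (h : IsChordalLoewnerChain D φ S γ g U)
    (hp : IsReferencePoint D φ S γ g U p) {t T M : ℝ} (ht : 0 ≤ t) (htT : t ≤ T) (hT : 1 ≤ T)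
    (htS : (t : EReal) < S) (hU : |U t| ≤ M) {N : ℕ} (hN : 320000 * (M + 8 * T) < N) :
    (1 / 2) ^ N * (1 / 640000 * (1 / 2) ^ N) * innerRadius D (p 0) ≤
      innerRadius (slitDomain D γ t) (p t) := by
  set A := (fun s ↦ φ (γ s)) '' Ioc 0 t with hA
  have hmo := h.mappingOut t ht htS
  obtain ⟨f, hf, hfinv⟩ := hmo.1.exists_inverse (h.isOpen_compl_image ht htS)
  have hfb : ∀ w : ℂ, 0 < w.im → w.im ≤ (f w).im ∧ ‖f w - w‖ * w.im ≤ 2 * t := fun w hw ↦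
    hmo.im_le_and_norm_sub_le (by positivity) (h.capacity t ht htS)
      (h.isBounded_image ht htS) hf hfinv hw
  obtain ⟨ψ, hψ, hinv⟩ := h.conformal.exists_inverse h.isOpen
  have hAsub : upperHalfPlaneSet \ A ⊆ upperHalfPlaneSet := sdiff_subset
  have hVsub : slitDomain D γ t ⊆ D := sdiff_subset
  have hψA : IsConformalMapOnto ψ (upperHalfPlaneSet \ A) (slitDomain D γ t) :=
    ⟨hψ.1.mono hAsub,
      (h.conformal_slitDomain htS).2.symm (hinv.mono hVsub hAsub).symm⟩
  have hF := hψA.comp hf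
  have hV : slitDomain D γ t ≠ univ := fun hc ↦ h.ne_univ (univ_subset_iff.1 (hc ▸ hVsub))
  obtain ⟨hpt, hgpt⟩ := hp t ht htS
  have hp_eq : (ψ ∘ f) (U t + Complex.I) = p t := by
    rw [← hgpt, Function.comp_apply,
      hfinv.1 ((h.conformal_slitDomain htS).2.mapsTo hpt), hinv.1 (hVsub hpt)]
  have h0S : ((0 : ℝ) : EReal) < S := by simpa using h.lifetime_pos
  have hp0_eq : ψ Complex.I = p 0 := by
    rw [← hp.apply_zero h]
    exact hinv.1 (hp 0 le_rfl h0S).1.1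
  -- This height gives `2t / Y ≤ 1/4` and, since `T ≥ 1`, also `16 * 2t ≤ Y ^ 2`, as the derivative
  -- bound requires.
  set Y := 8 * T with hY
  have hM : 0 ≤ M := (abs_nonneg _).trans hU
  set z : ℂ := U t + Y * Complex.I with hz
  have hzi : z.im = Y := by simp [hz]
  have hz0 : 0 < z.im := by rw [hzi]; positivity
  set ζ := f z with hζ
  obtain ⟨hζi, hζz⟩ := hfb z hz0
  have hζz' : ‖ζ - z‖ ≤ 1 / 4 := by
    rw [hzi] at hζz
    by_contra! hlt
    have := mul_lt_mul_of_pos_right hlt (by positivity : 0 < Y)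
    linarith
  have hζ0 : 0 < ζ.im := hz0.trans_le hζi
  have hζY : ζ.im ≤ 2 * Y := by
    have := (le_abs_self _).trans (Complex.abs_im_le_norm (ζ - z))
    rw [Complex.sub_im] at this
    linarith
  have hdist1 : dist z (U t + Complex.I) = Y - 1 := by
    have e : z - (U t + Complex.I) = ((Y - 1 : ℝ) : ℂ) * Complex.I := by
      rw [hz]; push_cast; ring
    rw [dist_eq_norm, e, norm_mul, Complex.norm_I, mul_one, Complex.norm_real, Real.norm_eq_abs,
      abs_of_nonneg (by linarith)]
  have hdist2 : dist Complex.I ζ ≤ M + Y := by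
    have h1 : dist ζ z ≤ 1 / 4 := by rwa [dist_eq_norm]
    have h2 : dist ((U t : ℂ) + Complex.I) Complex.I ≤ M := by
      rw [dist_eq_norm, add_sub_cancel_right, Complex.norm_real, Real.norm_eq_abs]
      exact hU
    rw [dist_comm]
    linarith [dist_triangle ζ z Complex.I, dist_triangle z (U t + Complex.I) Complex.I]
  have step1 : (1 / 2) ^ N * innerRadius (slitDomain D γ t) ((ψ ∘ f) z) ≤
      innerRadius (slitDomain D γ t) (p t) := by
    rw [← hp_eq]
    refine hF.half_pow_mul_innerRadius_le hV (by linarith) (by simp) ?_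
    rw [hdist1]
    linarith
  have step3 : (1 / 2) ^ N * innerRadius D (p 0) ≤ innerRadius D (ψ ζ) := by
    rw [← hp0_eq]
    refine hψ.half_pow_mul_innerRadius_le h.ne_univ (by simp) (by linarith) ?_
    linarith
  -- `640000 = 800 * 800`: two factors `400` from Koebe, one `2` from `Im ζ ≤ 2Y` and one from `|f'|
  -- ≥ 1/2`.
  have step2 : 1 / 640000 * innerRadius D (ψ ζ) ≤
      innerRadius (slitDomain D γ t) ((ψ ∘ f) z) := by
    have h1 := hF.im_mul_norm_deriv_le_innerRadius hV z
    have hopen := UpperHalfPlane.isOpen_upperHalfPlaneSet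
    have hder : deriv (ψ ∘ f) z = deriv ψ ζ * deriv f z :=
      deriv_comp z (hψ.1.differentiableAt (hopen.mem_nhds hζ0))
        (hf.1.differentiableAt (hopen.mem_nhds hz0))
    rw [hder, norm_mul, hzi] at h1
    have h2 : 1 / 2 ≤ ‖deriv f z‖ := by
      refine half_le_norm_deriv_of_norm_sub_mul_im_le hf.1 (fun w hw ↦ (hfb w hw).2) hz0 ?_
      rw [hzi]
      nlinarith
    have h3 := h.conformal.innerRadius_mul_norm_deriv_le_im (hψ.2.mapsTo (show ζ ∈ _ from hζ0))
    rw [hinv.2 (show ζ ∈ upperHalfPlaneSet from hζ0)] at h3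
    have h4 : ‖deriv φ (ψ ζ)‖ * ‖deriv ψ ζ‖ = 1 := by
      rw [← norm_mul, deriv_mul_deriv_of_leftInvOn hopen hψ.1 hinv.2 hζ0, norm_one]
    set ρ := innerRadius D (ψ ζ)
    have h5 : ρ / 400 ≤ 2 * Y * ‖deriv ψ ζ‖ :=
      calc ρ / 400 = ρ * ‖deriv φ (ψ ζ)‖ / 400 * ‖deriv ψ ζ‖ := by
            linear_combination (-ρ / 400) * h4
        _ ≤ 2 * Y * ‖deriv ψ ζ‖ := by
            gcongr
            exact h3.trans hζY
    have h6 : Y * ‖deriv ψ ζ‖ * (1 / 2) ≤ Y * ‖deriv ψ ζ‖ * ‖deriv f z‖ := by gcongr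
    linarith
  calc (1 / 2) ^ N * (1 / 640000 * (1 / 2) ^ N) * innerRadius D (p 0)
      = (1 / 2) ^ N * (1 / 640000 * ((1 / 2) ^ N * innerRadius D (p 0))) := by ring
    _ ≤ (1 / 2) ^ N * (1 / 640000 * innerRadius D (ψ ζ)) := by gcongr
    _ ≤ (1 / 2) ^ N * innerRadius (slitDomain D γ t) ((ψ ∘ f) z) := by gcongr
    _ ≤ _ := step1

/-- The guard `|U t| < 1 / ε` holds at every time before `|U|` first reaches `1 / ε`. -/
theorem mainTheorem9 (T ε : ℝ) (hT : 1 < T) (hε : 0 < ε) :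
    ∃ c : ℝ, 0 < c ∧
      ∀ (D : Set ℂ) (φ : ℂ → ℂ) (S : EReal) (γ : ℝ → ℂ) (g : ℝ → ℂ → ℂ) (U : ℝ → ℝ) (p : ℝ → ℂ),
        IsChordalLoewnerChain D φ S γ g U →
        IsReferencePoint D φ S γ g U p →
        ∀ t : ℝ, 0 ≤ t → t < lastTime S U T ε → |U t| < 1 / ε →
          c * innerRadius D (p 0) ≤ innerRadius (slitDomain D γ t) (p t) := by
  obtain ⟨N, hN⟩ := exists_nat_gt (320000 * (1 / ε + 8 * T))
  refine ⟨(1 / 2) ^ N * (1 / 640000 * (1 / 2) ^ N), by positivity, ?_⟩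
  intro D φ S γ g U p h hp t ht htl hUt
  -- Nonemptiness yields a time `s > t` in the set, which gives only `t ≤ T` and `t < S`; the bound
  -- on `U` at `t` itself is the separate guard.
  have hne : {t : ℝ | t ∈ Icc 0 T ∧ (t : EReal) < S ∧ |U t| < 1 / ε}.Nonempty :=
    ⟨0, ⟨le_rfl, by linarith⟩, by simpa using h.lifetime_pos, by
      rw [h.driving_zero, abs_zero]; positivity⟩
  obtain ⟨s, ⟨hsT, hsS, -⟩, hts⟩ := exists_lt_of_lt_csSup hne htl
  exact h.mul_innerRadius_le hp ht (hts.le.trans hsT.2) hT.le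
    (lt_trans (by exact_mod_cast hts) hsS) hUt.le hN
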